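/- Let $f_0:\mathbb{R}\to\mathbb{R}$ be an integrable differentiable function (for instance an equilibrium distribution function) whose derivative $f_0'$ is Hölder continuous on $\mathbb{R}$, i.e. $|f_0'(u)-f_0'(v)|\le C|u-v|^{\alpha}$ for all $u,v\in\mathbb{R}$, with some $\alpha>0$, $C\ge 0$. Then for every $u\in\mathbb{R}$ the Hilbert transform $$H[f_0'](u)=\frac1\pi\,\mathrm{PV}\!\int_{\mathbb{R}}\frac{f_0'(v)}{v-u}\,dv=\lim_{\varepsilon\to0^+,\,R\to\infty}\frac1\pi\int_{\varepsilon<|v-u|<R}\frac{f_0'(v)}{v-u}\,dv$$ exists, and the Penrose plot $$u\longmapsto 1-H[f_0'](u)-i f_0'(u),\qquad \infty\longmapsto 1,$$ is a continuous closed curve on $\mathbb{R}\cup\{\infty\}$. If it does not pass through the origin, then its winding number about the origin (the total increase, divided by $2\pi$, of a continuous argument along the curve as $u$ increases from $-\infty$ to $+\infty$) is well defined and nonnegative. The same holds for the curve $u\mapsto 1-\tilde H[f_0'](u)+i f_0'(u)$, $\infty\mapsto 1$, where $\tilde H=-H$ is the Hilbert transform with the opposite kernel, $\tilde H[f_0'](u)=\frac1\pi\mathrm{PV}\!\int_{\mathbb{R}}\frac{f_0'(v)}{u-v}\,dv$.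 -/

import Mathlib

open Filter Topology MeasureTheory
open scoped NNReal

noncomputable section

/-- The truncated Hilbert transform `(1/π) ∫_{ε < |v - u| < R} g(v) / (v - u) dv`. -/
def truncatedHilbert (g : ℝ → ℝ) (u ε R : ℝ) : ℝ :=
  (1 / Real.pi) * ∫ v in {v : ℝ | ε < |v - u| ∧ |v - u| < R}, g v / (v - u)

/-- The principal value `(1/π) PV ∫ g(v) / (v - u) dv` over the real line exists and equals `h`:
the truncated integrals converge to `h` as `ε → 0+` and `R → ∞`. -/
def HasHilbertTransformAt (g : ℝ → ℝ) (u h : ℝ) : Prop :=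
  Tendsto (fun p : ℝ × ℝ => truncatedHilbert g u p.1 p.2) (𝓝[>] 0 ×ˢ atTop) (𝓝 h)

/-- The Hilbert transform `H[g](u) = (1/π) PV ∫ g(v) / (v - u) dv`. -/
def hilbertTransform (g : ℝ → ℝ) (u : ℝ) : ℝ :=
  limUnder (𝓝[>] (0 : ℝ) ×ˢ (atTop : Filter ℝ))
    (fun p : ℝ × ℝ => truncatedHilbert g u p.1 p.2)

/-- The curve `γ` on the line, extended to the circle `ℝ ∪ {∞}` by the value `p` at `∞`. -/
def closeAtInfty (p : ℂ) (γ : ℝ → ℂ) : OnePoint ℝ → ℂ := fun x => x.elim p γ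

/-- The Penrose plot `u ↦ 1 - H[g](u) - i g(u)`, closed up by the value `1` at `u = ∞`.
It is the boundary value, from the upper half plane, of the plasma dispersion function
`z ↦ 1 - (1/π) ∫ g(v) / (v - z) dv`. -/
def penrosePlot (g : ℝ → ℝ) : OnePoint ℝ → ℂ :=
  closeAtInfty 1 fun u => 1 - (hilbertTransform g u : ℂ) - Complex.I * (g u : ℂ)

/-- The Penrose plot in the other usual convention for the Hilbert transform, with kernel
`1 / (u - v)`, that is `H'[g] = -H[g]`: the curve `u ↦ 1 - H'[g](u) + i g(u)`, closed up by the
value `1` at `u = ∞`. -/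
def penrosePlot' (g : ℝ → ℝ) : OnePoint ℝ → ℂ :=
  closeAtInfty 1 fun u => 1 - ((-hilbertTransform g u : ℝ) : ℂ) + Complex.I * (g u : ℂ)

/-- The curve `γ` on `ℝ ∪ {∞}`, traversed in the direction of increasing `u`, avoids `z` and has
winding number `n` about `z`: a continuous choice `θ` of the argument of `γ - z` along the real
line increases by `2πn` in total, from `u = -∞` to `u = +∞`. -/
def HasWindingNumber (γ : OnePoint ℝ → ℂ) (z : ℂ) (n : ℤ) : Prop :=
  Continuous γ ∧ (∀ x, γ x ≠ z) ∧
    ∃ θ : ℝ → ℝ, Continuous θ ∧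
      (∀ u : ℝ, γ u - z = (‖γ u - z‖ : ℂ) * Complex.exp (Complex.I * (θ u : ℂ))) ∧
      ∃ a b : ℝ, Tendsto θ atBot (𝓝 a) ∧ Tendsto θ atTop (𝓝 b) ∧ b - a = 2 * Real.pi * n

end

/-!
The Penrose plot is the boundary curve of the plasma dispersion function
`D z = 1 - (1/π) ∫ f₀'(v) / (v - z) dv`, which is holomorphic in the upper half plane. Integration
by parts turns the integral into `∫ f₀(v) / (v - z) ^ 2 dv`. With `z = u + iy`, its imaginary part
is the Poisson integral of `f₀'`, and its real part is
`∫_{t > 0} (f₀(u + t) + f₀(u - t) - 2 f₀(u)) (t ^ 2 - y ^ 2) / (t ^ 2 + y ^ 2) ^ 2 dt`, where the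
even kernel has integral zero, which allows the subtraction of `2 f₀(u)`. The modulus of continuity
of `f₀'` makes the second difference over `t ^ 2` integrable uniformly in `u`, so dominated
convergence extends `D` continuously to the real line, with the limit `1` at infinity, and
identifies the boundary values with `1 - H[f₀'] - i f₀'`.

The Cayley transform carries `D` to a function holomorphic in the unit disc and continuous up to
the circle. If it has no zeros on the circle, it has finitely many in the disc. Each factor `w - b`
with `|b| < 1` has winding number one along the circle, and a function without zeros in the closed
disc has a continuous logarithm, so the winding number is the number of zeros, counted with
multiplicity. The second curve is the boundary curve of `2 - D`.
-/

/-! ### Winding numbers -/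

theorem HasWindingNumber.unique {γ : OnePoint ℝ → ℂ} {z : ℂ} {m n : ℤ}
    (hm : HasWindingNumber γ z m) (hn : HasWindingNumber γ z n) : m = n := by
  obtain ⟨-, hne, θ, hθ, hθγ, a, b, ha, hb, hab⟩ := hm
  obtain ⟨-, -, η, hη, hηγ, c, d, hc, hd, hcd⟩ := hn
  have two_pi_ne : 2 * Real.pi ≠ 0 := Real.two_pi_pos.ne'
  have exists_int : ∀ u, ∃ k : ℤ, (θ u - η u) / (2 * Real.pi) = k := by
    intro u
    have norm_ne : (‖γ u - z‖ : ℂ) ≠ 0 := by simpa [sub_eq_zero] using hne u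
    obtain ⟨k, hk⟩ := Complex.exp_eq_exp_iff_exists_int.1
      (mul_left_cancel₀ norm_ne ((hθγ u).symm.trans (hηγ u)))
    have hk_im : θ u = η u + k * (2 * Real.pi) := by simpa using congrArg Complex.im hk
    exact ⟨k, by rw [div_eq_iff two_pi_ne, hk_im, add_sub_cancel_left]⟩
  choose k hk using exists_int
  have hk_cont : Continuous k := by
    rw [Int.isClosedEmbedding_coe_real.isEmbedding.continuous_iff,
      show ((↑) : ℤ → ℝ) ∘ k = fun u => (θ u - η u) / (2 * Real.pi) from
        funext fun u => (hk u).symm]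
    fun_prop
  have hconst : ∀ u, θ u - η u = k 0 * (2 * Real.pi) := fun u => by
    rw [← div_eq_iff two_pi_ne, hk u,
      (PreconnectedSpace.constant inferInstance hk_cont : k u = k 0)]
  have hlim {l : Filter ℝ} [l.NeBot] {x y : ℝ} (hx : Tendsto θ l (𝓝 x))
      (hy : Tendsto η l (𝓝 y)) : x - y = k 0 * (2 * Real.pi) :=
    tendsto_nhds_unique (hx.sub hy) (by simp only [hconst]; exact tendsto_const_nhds)
  have h : 2 * Real.pi * (m : ℝ) = 2 * Real.pi * n := by linarith [hlim ha hc, hlim hb hd]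
  exact_mod_cast mul_left_cancel₀ two_pi_ne h

theorem HasWindingNumber.mul {γ₁ γ₂ : OnePoint ℝ → ℂ} {m n : ℤ}
    (h₁ : HasWindingNumber γ₁ 0 m) (h₂ : HasWindingNumber γ₂ 0 n) :
    HasWindingNumber (fun x => γ₁ x * γ₂ x) 0 (m + n) := by
  obtain ⟨hγ₁, hne₁, θ, hθ, hθγ, a, b, ha, hb, hab⟩ := h₁
  obtain ⟨hγ₂, hne₂, η, hη, hηγ, c, d, hc, hd, hcd⟩ := h₂
  refine ⟨hγ₁.mul hγ₂, fun x => mul_ne_zero (hne₁ x) (hne₂ x), fun u => θ u + η u,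
    hθ.add hη, fun u => ?_, a + c, b + d, ha.add hc, hb.add hd, ?_⟩
  · simp only [sub_zero] at hθγ hηγ ⊢
    rw [norm_mul, Complex.ofReal_add, Complex.ofReal_mul, mul_add, Complex.exp_add,
      mul_mul_mul_comm, ← hθγ u, ← hηγ u]
  · push_cast
    linarith

theorem HasWindingNumber.of_exp {k : OnePoint ℝ → ℂ} (hk : Continuous k) :
    HasWindingNumber (fun x => Complex.exp (k x)) 0 0 := by
  obtain ⟨hk_infty, hk_coe⟩ := (OnePoint.continuous_iff k).1 hk
  rw [coclosedCompact_eq_cocompact] at hk_infty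
  have him := (Complex.continuous_im.tendsto _).comp hk_infty
  refine ⟨Complex.continuous_exp.comp hk, fun x => Complex.exp_ne_zero _, fun u => (k u).im,
    Complex.continuous_im.comp hk_coe, fun u => ?_, _, _, him.mono_left atBot_le_cocompact,
    him.mono_left atTop_le_cocompact, by simp⟩
  rw [sub_zero, Complex.norm_exp, Complex.ofReal_exp, ← Complex.exp_add, mul_comm Complex.I,
    Complex.re_add_im]

theorem HasWindingNumber.pow {γ : OnePoint ℝ → ℂ} {m : ℤ} (h : HasWindingNumber γ 0 m) (n : ℕ) :
    HasWindingNumber (fun x => γ x ^ n) 0 (n * m) := by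
  induction n with
  | zero => simpa using HasWindingNumber.of_exp (k := fun _ => 0) continuous_const
  | succ n ih => simpa only [pow_succ, Nat.cast_succ, add_one_mul] using ih.mul h

theorem continuous_closeAtInfty {γ : ℝ → ℂ} {p : ℂ} (hγ : Continuous γ)
    (hp : Tendsto γ (cocompact ℝ) (𝓝 p)) : Continuous (closeAtInfty p γ) :=
  (OnePoint.continuous_iff _).2 ⟨by rwa [coclosedCompact_eq_cocompact], hγ⟩

/-! ### The Cayley transform -/

/-- The parametrization `u ↦ (u - i) / (u + i)`, `∞ ↦ 1` of the unit circle by `ℝ ∪ {∞}`. -/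
noncomputable def cayleyCircle : OnePoint ℝ → ℂ :=
  closeAtInfty 1 fun u => (u - Complex.I) / (u + Complex.I)

theorem cayleyCircle_coe (u : ℝ) :
    cayleyCircle (u : OnePoint ℝ) = (u - Complex.I) / (u + Complex.I) := rfl

theorem add_I_ne_zero {z : ℂ} (hz : 0 ≤ z.im) : z + Complex.I ≠ 0 := fun h => by
  have : z.im + 1 = 0 := by simpa using congrArg Complex.im h
  linarith

theorem ofReal_add_I_ne_zero (u : ℝ) : (u : ℂ) + Complex.I ≠ 0 :=
  add_I_ne_zero (Complex.ofReal_im u).ge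

theorem norm_cayleyCircle (x : OnePoint ℝ) : ‖cayleyCircle x‖ = 1 := by
  induction x using OnePoint.rec with
  | infty => exact norm_one
  | coe u =>
    rw [cayleyCircle_coe, norm_div, div_eq_one_iff_eq (by simpa using ofReal_add_I_ne_zero u),
      ← Complex.norm_conj]
    simp [Complex.conj_ofReal]

theorem continuous_cayleyCircle : Continuous cayleyCircle := by
  refine continuous_closeAtInfty
    (Continuous.div (by fun_prop) (by fun_prop) ofReal_add_I_ne_zero) ?_
  have hcob : Tendsto (fun u : ℝ => (u : ℂ) + Complex.I) (cocompact ℝ)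
      (Bornology.cobounded ℂ) := by
    rw [Metric.cobounded_eq_cocompact]
    exact (Homeomorph.addRight Complex.I).isClosedEmbedding.tendsto_cocompact.comp
      Complex.isometry_ofReal.isClosedEmbedding.tendsto_cocompact
  have hlim : Tendsto (fun u : ℝ => 1 - 2 * Complex.I * ((u : ℂ) + Complex.I)⁻¹) (cocompact ℝ)
      (𝓝 1) := by
    simpa using ((tendsto_inv₀_cobounded.comp hcob).const_mul (2 * Complex.I)).const_sub 1
  refine hlim.congr fun u => ?_
  field_simp [ofReal_add_I_ne_zero u]
  ring

theorem exp_I_mul_two_mul_arctan_add_pi (u : ℝ) :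
    Complex.exp (Complex.I * ((2 * Real.arctan u + Real.pi : ℝ) : ℂ)) = cayleyCircle u := by
  have hnum : 1 + (u : ℂ) * Complex.I ≠ 0 := fun h => by simpa using congrArg Complex.re h
  have hden : 1 - (u : ℂ) * Complex.I ≠ 0 := fun h => by simpa using congrArg Complex.re h
  have harg : Complex.I * ((2 * Real.arctan u + Real.pi : ℝ) : ℂ) =
      Complex.log ((1 + u * Complex.I) / (1 - u * Complex.I)) + Real.pi * Complex.I := by
    rw [Complex.ofReal_add, Complex.ofReal_mul, Complex.ofReal_arctan, Complex.arctan]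
    push_cast
    linear_combination
      -Complex.log ((1 + u * Complex.I) / (1 - u * Complex.I)) * Complex.I_sq
  rw [harg, Complex.exp_add, Complex.exp_log (div_ne_zero hnum hden), Complex.exp_pi_mul_I,
    cayleyCircle_coe, mul_neg_one, neg_div', div_eq_div_iff hden (ofReal_add_I_ne_zero u)]
  ring_nf
  simp only [Complex.I_sq]
  ring

theorem hasWindingNumber_cayleyCircle : HasWindingNumber cayleyCircle 0 1 := by
  refine ⟨continuous_cayleyCircle, fun x h => ?_, fun u => 2 * Real.arctan u + Real.pi,
    by fun_prop, fun u => ?_, 2 * -(Real.pi / 2) + Real.pi, 2 * (Real.pi / 2) + Real.pi,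
    ((Real.tendsto_arctan_atBot.mono_right nhdsWithin_le_nhds).const_mul 2).add_const _,
    ((Real.tendsto_arctan_atTop.mono_right nhdsWithin_le_nhds).const_mul 2).add_const _,
    by push_cast; ring⟩
  · simpa [h] using norm_cayleyCircle x
  · rw [sub_zero, norm_cayleyCircle, exp_I_mul_two_mul_arctan_add_pi, Complex.ofReal_one, one_mul]

theorem hasWindingNumber_cayleyCircle_sub {b : ℂ} (hb : ‖b‖ < 1) :
    HasWindingNumber (fun x => cayleyCircle x - b) 0 1 := by
  have hslit : ∀ x, 1 - b * (starRingEnd ℂ) (cayleyCircle x) ∈ Complex.slitPlane := fun x => by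
    rw [sub_eq_add_neg]
    exact Complex.mem_slitPlane_of_norm_lt_one (by simpa [norm_cayleyCircle] using hb)
  have hlog : Continuous fun x => Complex.log (1 - b * (starRingEnd ℂ) (cayleyCircle x)) :=
    Continuous.clog (continuous_const.sub (continuous_const.mul
      (Complex.continuous_conj.comp continuous_cayleyCircle))) hslit
  -- On the unit circle `w - b = w (1 - b w̄)`, and the second factor has a continuous logarithm.
  rw [← add_zero (1 : ℤ)]
  convert hasWindingNumber_cayleyCircle.mul (HasWindingNumber.of_exp hlog) using 2 with x
  have hunit : cayleyCircle x * (starRingEnd ℂ) (cayleyCircle x) = 1 := by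
    simp [Complex.mul_conj, Complex.normSq_eq_norm_sq, norm_cayleyCircle]
  rw [Complex.exp_log (Complex.slitPlane_ne_zero (hslit x))]
  linear_combination b * hunit

/-! ### The argument principle -/

theorem diffContOnCl_dslope {F : ℂ → ℂ} {U : Set ℂ} {b : ℂ} (hF : DiffContOnCl ℂ F U)
    (hU : U ∈ 𝓝 b) : DiffContOnCl ℂ (dslope F b) U :=
  ⟨(Complex.differentiableOn_dslope hU).2 hF.differentiableOn,
    (continuousOn_dslope (mem_of_superset hU subset_closure)).2
      ⟨hF.continuousOn, hF.differentiableAt' hU⟩⟩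

theorem exists_eq_pow_mul_of_analyticOrderAt_eq {U : Set ℂ} {b : ℂ} (hU : U ∈ 𝓝 b) (n : ℕ)
    {F : ℂ → ℂ} (hF : DiffContOnCl ℂ F U) (hn : analyticOrderAt F b = n) :
    ∃ G : ℂ → ℂ, DiffContOnCl ℂ G U ∧ G b ≠ 0 ∧ ∀ w, F w = (w - b) ^ n * G w := by
  have han {F : ℂ → ℂ} (hF : DiffContOnCl ℂ F U) : AnalyticAt ℂ F b :=
    hF.differentiableOn.analyticAt hU
  induction n generalizing F with
  | zero => exact ⟨F, hF, (han hF).analyticOrderAt_eq_zero.1 hn, by simp⟩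
  | succ n ih =>
    have hFb : F b = 0 := (han hF).analyticOrderAt_ne_zero.1 (by simp [hn])
    have hfactor : F = (fun w => w - b) * dslope F b := funext fun w => by
      simpa [hFb] using (sub_smul_dslope F b w).symm
    have hdslope := diffContOnCl_dslope hF hU
    have horder : analyticOrderAt (dslope F b) b = n := by
      have hsub : analyticOrderAt (fun w : ℂ => w - b) b = 1 :=
        AnalyticAt.analyticOrderAt_sub_eq_one_of_deriv_ne_zero (f := id) analyticAt_id (by simp)
      rw [hfactor, analyticOrderAt_mul (by fun_prop) (han hdslope), hsub, add_comm,
        Nat.cast_succ] at hn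
      exact WithTop.add_right_cancel ENat.one_ne_top hn
    obtain ⟨G, hG, hGb, hdG⟩ := ih hdslope horder
    refine ⟨G, hG, hGb, fun w => ?_⟩
    rw [congrFun hfactor w, Pi.mul_apply, hdG w, pow_succ', mul_assoc]

theorem hasWindingNumber_comp_cayleyCircle_of_ne_zero {F : ℂ → ℂ}
    (hF : ContinuousOn F (Metric.closedBall 0 1)) (h0 : ∀ w ∈ Metric.closedBall 0 1, F w ≠ 0) :
    HasWindingNumber (fun x => F (cayleyCircle x)) 0 0 := by
  -- Composing with the radial retraction onto the disc makes `F` zero-free on all of `ℂ`.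
  let r : ℂ → ℂ := fun w => w / (max 1 ‖w‖ : ℝ)
  have hmax (w : ℂ) : 0 < max 1 ‖w‖ := by positivity
  have hr : Continuous r :=
    continuous_id.div (by fun_prop) fun w => Complex.ofReal_ne_zero.2 (hmax w).ne'
  have hr_mem (w : ℂ) : r w ∈ Metric.closedBall 0 1 := by
    rw [mem_closedBall_zero_iff, norm_div, Complex.norm_real, Real.norm_of_nonneg (hmax w).le,
      div_le_one (hmax w)]
    exact le_max_right _ _
  have hsimply : IsSimplyConnected (Set.univ : Set ℂ) :=
    have : ContractibleSpace (Set.univ : Set ℂ) :=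
      convex_univ.contractibleSpace Set.univ_nonempty
    inferInstanceAs (SimplyConnectedSpace (Set.univ : Set ℂ))
  obtain ⟨k, hk, hkF⟩ := Complex.exists_continuousOn_eqOn_exp_comp (g := F ∘ r) hsimply
    isOpen_univ (hF.comp_continuous hr hr_mem).continuousOn
    (by rintro ⟨w, -, hw⟩; exact h0 _ (hr_mem w) hw)
  have hexp (x : OnePoint ℝ) : F (cayleyCircle x) = Complex.exp (k (cayleyCircle x)) := by
    simpa [r, norm_cayleyCircle] using (hkF (Set.mem_univ (cayleyCircle x))).symm
  simpa only [hexp, Function.comp_apply] using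
    HasWindingNumber.of_exp ((continuousOn_univ.1 hk).comp continuous_cayleyCircle)

theorem exists_hasWindingNumber_of_zeros_subset (s : Finset ℂ) {F : ℂ → ℂ}
    (hF : DiffContOnCl ℂ F (Metric.ball 0 1)) (hs : ↑s ⊆ Metric.ball (0 : ℂ) 1)
    (hzeros : ∀ w ∈ Metric.closedBall 0 1, F w = 0 → w ∈ s) :
    ∃ n : ℕ, HasWindingNumber (fun x => F (cayleyCircle x)) 0 n := by
  induction s using Finset.induction_on generalizing F with
  | empty =>
    exact ⟨0, hasWindingNumber_comp_cayleyCircle_of_ne_zero hF.continuousOn_ball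
      fun w hw h => Finset.notMem_empty w (hzeros w hw h)⟩
  | insert b s hbs ih =>
    have hb : b ∈ Metric.ball (0 : ℂ) 1 := hs (by simp)
    have hball := Metric.isOpen_ball.mem_nhds hb
    have hiso : ∀ᶠ w in 𝓝[≠] b, F w ≠ 0 := by
      have hs_compl : ∀ᶠ w in 𝓝 b, w ∉ s :=
        s.finite_toSet.isClosed.isOpen_compl.mem_nhds (by simpa using hbs)
      filter_upwards [nhdsWithin_le_nhds hball, nhdsWithin_le_nhds hs_compl,
        self_mem_nhdsWithin] with w hw_ball hws hwb h
      exact (Finset.mem_insert.1 (hzeros w (Metric.ball_subset_closedBall hw_ball) h)).elim hwb hws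
    have horder : analyticOrderAt F b ≠ ⊤ := fun h => by
      have := (analyticOrderAt_eq_top.1 h).filter_mono (nhdsWithin_le_nhds (s := {b}ᶜ))
      exact (hiso.and this).exists.elim fun w hw => hw.1 hw.2
    obtain ⟨n, hn⟩ := ENat.ne_top_iff_exists.1 horder
    obtain ⟨G, hG, hGb, hFG⟩ := exists_eq_pow_mul_of_analyticOrderAt_eq hball n hF hn.symm
    obtain ⟨m, hm⟩ := ih hG (fun w hw => hs (Finset.mem_insert_of_mem hw)) fun w hw h =>
      (Finset.mem_insert.1 (hzeros w hw (by rw [hFG w, h, mul_zero]))).resolve_left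
        (by rintro rfl; exact hGb h)
    refine ⟨n + m, ?_⟩
    simpa [hFG] using
      ((hasWindingNumber_cayleyCircle_sub (mem_ball_zero_iff.1 hb)).pow n).mul hm

theorem finite_zeros_of_diffContOnCl {F : ℂ → ℂ} (hF : DiffContOnCl ℂ F (Metric.ball 0 1))
    (h0 : ∀ w ∈ Metric.sphere 0 1, F w ≠ 0) : {w ∈ Metric.closedBall 0 1 | F w = 0}.Finite := by
  set Z := {w ∈ Metric.closedBall 0 1 | F w = 0}
  have hZ_compact : IsCompact Z :=
    (isCompact_closedBall (0 : ℂ) 1).of_isClosed_subset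
      (hF.continuousOn_ball.preimage_isClosed_of_isClosed Metric.isClosed_closedBall
        isClosed_singleton) fun w hw => hw.1
  by_contra hinf
  obtain ⟨b, hbZ, hb⟩ := Set.Infinite.exists_accPt_of_subset_isCompact hinf hZ_compact subset_rfl
  have hb_ball : b ∈ Metric.ball (0 : ℂ) 1 :=
    mem_ball_zero_iff.2 (lt_of_le_of_ne (mem_closedBall_zero_iff.1 hbZ.1)
      fun h => h0 b (mem_sphere_zero_iff_norm.2 h) hbZ.2)
  have hzero_ball : Set.EqOn F 0 (Metric.ball 0 1) :=
    (hF.differentiableOn.analyticOnNhd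
      Metric.isOpen_ball).eqOn_zero_of_preconnected_of_frequently_eq_zero
      (convex_ball (0 : ℂ) 1).isPreconnected hb_ball
      ((accPt_iff_frequently_nhdsNE.1 hb).mono fun w hw => hw.2)
  have hzero : Set.EqOn F 0 (closure (Metric.ball 0 1)) :=
    hzero_ball.of_subset_closure hF.continuousOn continuousOn_const subset_closure subset_rfl
  exact h0 1 (by simp) (hzero (by simp [closure_ball]))

theorem exists_hasWindingNumber_comp_cayleyCircle {F : ℂ → ℂ}
    (hF : DiffContOnCl ℂ F (Metric.ball 0 1)) (h0 : ∀ w ∈ Metric.sphere 0 1, F w ≠ 0) :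
    ∃ n : ℕ, HasWindingNumber (fun x => F (cayleyCircle x)) 0 n := by
  have hfin := finite_zeros_of_diffContOnCl hF h0
  refine exists_hasWindingNumber_of_zeros_subset hfin.toFinset hF (fun w hw => ?_)
    fun w hw h => hfin.mem_toFinset.2 ⟨hw, h⟩
  obtain ⟨hw_ball, hFw⟩ := hfin.mem_toFinset.1 hw
  exact mem_ball_zero_iff.2 (lt_of_le_of_ne (mem_closedBall_zero_iff.1 hw_ball)
    fun h => h0 w (mem_sphere_zero_iff_norm.2 h) hFw)

/-- The inverse Cayley transform `w ↦ i (1 + w) / (1 - w)` from the unit disc to the upper half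
plane. -/
noncomputable def inverseCayley (w : ℂ) : ℂ := Complex.I * (1 + w) / (1 - w)

theorem inverseCayley_im (w : ℂ) : (inverseCayley w).im = (1 - ‖w‖ ^ 2) / ‖1 - w‖ ^ 2 := by
  rw [← Complex.normSq_eq_norm_sq, ← Complex.normSq_eq_norm_sq, inverseCayley, Complex.div_im]
  simp only [Complex.normSq_apply, Complex.mul_re, Complex.mul_im, Complex.I_re, Complex.I_im,
    Complex.add_re, Complex.add_im, Complex.sub_re, Complex.sub_im, Complex.one_re, Complex.one_im]
  ring

theorem inverseCayley_im_nonneg {w : ℂ} (hw : w ∈ Metric.closedBall 0 1) :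
    0 ≤ (inverseCayley w).im := by
  rw [inverseCayley_im]
  exact div_nonneg (sub_nonneg.2 (pow_le_one₀ (norm_nonneg w) (mem_closedBall_zero_iff.1 hw)))
    (by positivity)

theorem inverseCayley_im_pos {w : ℂ} (hw : w ∈ Metric.ball 0 1) : 0 < (inverseCayley w).im := by
  have hw' := mem_ball_zero_iff.1 hw
  have hw1 : 0 < ‖1 - w‖ := norm_pos_iff.2 (sub_ne_zero.2 fun h => by simp [← h] at hw')
  rw [inverseCayley_im]
  exact div_pos (sub_pos.2 (pow_lt_one₀ (norm_nonneg w) hw' two_ne_zero)) (by positivity)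

theorem differentiableAt_inverseCayley {w : ℂ} (hw : w ≠ 1) :
    DifferentiableAt ℂ inverseCayley w :=
  .div (by fun_prop) (by fun_prop) (sub_ne_zero.2 hw.symm)

theorem cayleyCircle_coe_ne_one (u : ℝ) : cayleyCircle u ≠ 1 := fun h => by
  rw [cayleyCircle_coe, div_eq_one_iff_eq (ofReal_add_I_ne_zero u)] at h
  norm_num [Complex.ext_iff] at h

theorem cayleyCircle_inverseCayley_re {w : ℂ} (hw : ‖w‖ = 1) (hw1 : w ≠ 1) :
    cayleyCircle (inverseCayley w).re = w := by
  have hreal : ((inverseCayley w).re : ℂ) = inverseCayley w :=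
    Complex.ext (by simp) (by simp [inverseCayley_im, hw])
  have hden : 1 - w ≠ 0 := sub_ne_zero.2 hw1.symm
  rw [cayleyCircle_coe, div_eq_iff (ofReal_add_I_ne_zero _), hreal, inverseCayley]
  field_simp
  ring

theorem inverseCayley_cayleyCircle (u : ℝ) : inverseCayley (cayleyCircle u) = u := by
  have hden : 1 - cayleyCircle u ≠ 0 := sub_ne_zero.2 (cayleyCircle_coe_ne_one u).symm
  have hadd := ofReal_add_I_ne_zero u
  rw [inverseCayley, div_eq_iff hden, cayleyCircle_coe]
  field_simp
  ring

theorem tendsto_inverseCayley :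
    Tendsto inverseCayley (𝓝[Metric.closedBall 0 1 \ {1}] 1)
      (cocompact ℂ ⊓ 𝓟 {z | 0 ≤ z.im}) := by
  refine tendsto_inf.2 ⟨?_, tendsto_principal.2 ?_⟩
  · have hsub : Tendsto (fun w : ℂ => 1 - w) (𝓝[≠] 1) (𝓝[≠] 0) :=
      tendsto_nhdsWithin_iff.2
        ⟨((continuous_sub_left (1 : ℂ)).tendsto' 1 0 (sub_self 1)).mono_left nhdsWithin_le_nhds,
          by filter_upwards [self_mem_nhdsWithin] with w hw using sub_ne_zero.2 (Ne.symm hw)⟩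
    have hpole : Tendsto (fun w : ℂ => 2 * Complex.I * (1 - w)⁻¹ + -Complex.I) (𝓝[≠] 1)
        (Bornology.cobounded ℂ) :=
      (tendsto_add_const_cobounded (-Complex.I)).comp ((tendsto_mul_left_cobounded (by simp)).comp
        (tendsto_inv₀_nhdsNE_zero.comp hsub))
    rw [← Metric.cobounded_eq_cocompact]
    refine (hpole.congr' ?_).mono_left (nhdsWithin_mono _ fun w hw => hw.2)
    filter_upwards [self_mem_nhdsWithin] with w hw
    have hden : 1 - w ≠ 0 := sub_ne_zero.2 (Ne.symm hw)
    rw [inverseCayley]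
    field_simp
    ring
  · filter_upwards [self_mem_nhdsWithin] with w hw using inverseCayley_im_nonneg hw.1

theorem diffContOnCl_update_comp_inverseCayley {F : ℂ → ℂ} {p : ℂ}
    (hF : DiffContOnCl ℂ F {z | 0 < z.im})
    (hp : Tendsto F (cocompact ℂ ⊓ 𝓟 {z | 0 ≤ z.im}) (𝓝 p)) :
    DiffContOnCl ℂ (Function.update (F ∘ inverseCayley) 1 p) (Metric.ball 0 1) := by
  have hcont : ContinuousOn F {z | 0 ≤ z.im} := by
    simpa only [Complex.closure_setOfPred_lt_im] using hF.continuousOn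
  refine .mk_ball (fun w hw => ?_) fun w hw => ?_
  · have hw1 : w ≠ 1 := by rintro rfl; simp at hw
    have hFw : DifferentiableAt ℂ F (inverseCayley w) :=
      hF.differentiableAt (isOpen_lt continuous_const Complex.continuous_im)
        (inverseCayley_im_pos hw)
    refine ((hFw.comp w (differentiableAt_inverseCayley hw1)).congr_of_eventuallyEq
      ?_).differentiableWithinAt
    filter_upwards [isOpen_ne.mem_nhds hw1] with v hv using Function.update_of_ne hv _ _
  · rcases eq_or_ne w 1 with rfl | hw1
    · rw [continuousWithinAt_update_same]
      exact hp.comp tendsto_inverseCayley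
    · rw [continuousWithinAt_update_of_ne hw1]
      exact (hcont _ (inverseCayley_im_nonneg hw)).comp
        (differentiableAt_inverseCayley hw1).continuousAt.continuousWithinAt
        fun v hv => inverseCayley_im_nonneg hv

theorem exists_hasWindingNumber_boundary_values {F : ℂ → ℂ} {p : ℂ}
    (hF : DiffContOnCl ℂ F {z | 0 < z.im})
    (hp : Tendsto F (cocompact ℂ ⊓ 𝓟 {z | 0 ≤ z.im}) (𝓝 p)) (hp0 : p ≠ 0)
    (h0 : ∀ u : ℝ, F u ≠ 0) :
    ∃ n : ℕ, HasWindingNumber (closeAtInfty p fun u => F u) 0 n := by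
  have hcurve (x : OnePoint ℝ) : Function.update (F ∘ inverseCayley) 1 p (cayleyCircle x) =
      closeAtInfty p (fun u => F u) x := by
    induction x using OnePoint.rec with
    | infty => exact Function.update_self ..
    | coe u =>
      rw [Function.update_of_ne (cayleyCircle_coe_ne_one u), Function.comp_apply,
        inverseCayley_cayleyCircle]
      rfl
  simp only [← funext hcurve]
  refine exists_hasWindingNumber_comp_cayleyCircle
    (diffContOnCl_update_comp_inverseCayley hF hp) fun w hw => ?_
  rcases eq_or_ne w 1 with rfl | hw1
  · rwa [Function.update_self]
  · rw [← cayleyCircle_inverseCayley_re (mem_sphere_zero_iff_norm.1 hw) hw1, hcurve]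
    exact h0 _

theorem continuous_closeAtInfty_boundary_values {F : ℂ → ℂ} {p : ℂ}
    (hF : DiffContOnCl ℂ F {z | 0 < z.im})
    (hp : Tendsto F (cocompact ℂ ⊓ 𝓟 {z | 0 ≤ z.im}) (𝓝 p)) :
    Continuous (closeAtInfty p fun u : ℝ => F u) := by
  have him (u : ℝ) : (u : ℂ) ∈ {z : ℂ | 0 ≤ z.im} := (Complex.ofReal_im u).ge
  refine continuous_closeAtInfty (hF.continuousOn.comp_continuous Complex.continuous_ofReal
    fun u => by simpa only [Complex.closure_setOfPred_lt_im] using him u) (hp.comp ?_)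
  exact tendsto_inf.2 ⟨Complex.isometry_ofReal.isClosedEmbedding.tendsto_cocompact,
    tendsto_principal.2 (Eventually.of_forall him)⟩

theorem existsUnique_hasWindingNumber_boundary_values {F : ℂ → ℂ} {p : ℂ}
    (hF : DiffContOnCl ℂ F {z | 0 < z.im})
    (hp : Tendsto F (cocompact ℂ ⊓ 𝓟 {z | 0 ≤ z.im}) (𝓝 p)) (hp0 : p ≠ 0)
    (h0 : ∀ u : ℝ, F u ≠ 0) :
    (∃! n : ℤ, HasWindingNumber (closeAtInfty p fun u => F u) 0 n) ∧
      ∀ n : ℤ, HasWindingNumber (closeAtInfty p fun u => F u) 0 n → 0 ≤ n := by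
  obtain ⟨n, hn⟩ := exists_hasWindingNumber_boundary_values hF hp hp0 h0
  exact ⟨⟨n, hn, fun m hm => hm.unique hn⟩, fun m hm => hm.unique hn ▸ Int.natCast_nonneg n⟩

/-! ### Second differences and regular profiles -/

/-- The symmetric second difference of `f` at `u` with step `t`. -/
def secondDiff (f : ℝ → ℝ) (u t : ℝ) : ℝ := f (u + t) + f (u - t) - 2 * f u

theorem secondDiff_zero (f : ℝ → ℝ) (u : ℝ) : secondDiff f u 0 = 0 := by
  simp only [secondDiff, add_zero, sub_zero]
  ring

theorem abs_secondDiff_le {f : ℝ → ℝ} {K : ℝ} (hK : ∀ x, |f x| ≤ K) (u t : ℝ) :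
    |secondDiff f u t| ≤ 4 * K :=
  calc |secondDiff f u t| ≤ |f (u + t)| + |f (u - t)| + |2 * f u| :=
        (abs_sub _ _).trans (add_le_add_left (abs_add_le _ _) _)
    _ ≤ K + K + 2 * K := by
        rw [abs_mul, abs_two]
        gcongr <;> exact hK _
    _ = 4 * K := by ring

theorem continuous_secondDiff {f : ℝ → ℝ} (hf : Continuous f) :
    Continuous fun p : ℝ × ℝ => secondDiff f p.1 p.2 := by
  unfold secondDiff
  fun_prop

theorem hasDerivAt_secondDiff {f g : ℝ → ℝ} (hf : ∀ x, HasDerivAt f (g x) x) (u t : ℝ) :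
    HasDerivAt (secondDiff f u) (g (u + t) - g (u - t)) t :=
  (((hf (u + t)).comp_const_add u t).add ((hf (u - t)).comp_const_sub u t)).sub_const (2 * f u)

theorem exists_hasDerivAt_mul_eq_sub {f g : ℝ → ℝ} (hf : ∀ x, HasDerivAt f (g x) x) (x : ℝ)
    {h : ℝ} (hh : 0 < h) : ∃ ξ ∈ Set.Ioo x (x + h), f (x + h) - f x = h * g ξ := by
  obtain ⟨ξ, hξ, hslope⟩ := exists_hasDerivAt_eq_slope f g (lt_add_of_pos_right x hh)
    (fun y _ => (hf y).continuousAt.continuousWithinAt) fun y _ => hf y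
  refine ⟨ξ, hξ, ?_⟩
  rw [hslope, add_sub_cancel_left, mul_div_cancel₀ _ hh.ne']

theorem exists_secondDiff_eq_mul_sub {f g : ℝ → ℝ} (hf : ∀ x, HasDerivAt f (g x) x) (u : ℝ)
    {t : ℝ} (ht : 0 < t) :
    ∃ ξ ∈ Set.Ioo (u - t) u, secondDiff f u t = t * (g (ξ + t) - g ξ) := by
  have hderiv (x : ℝ) : HasDerivAt (fun x => f (x + t) - f x) (g (x + t) - g x) x :=
    ((hf (x + t)).comp_add_const x t).sub (hf x)
  obtain ⟨ξ, hξ, hmean⟩ := exists_hasDerivAt_mul_eq_sub hderiv (u - t) ht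
  rw [sub_add_cancel] at hξ hmean
  exact ⟨ξ, hξ, by rw [← hmean, secondDiff]; ring⟩

theorem exists_secondDiff_eq_sq_mul {P f g : ℝ → ℝ} (hP : ∀ x, HasDerivAt P (f x) x)
    (hf : ∀ x, HasDerivAt f (g x) x) (u : ℝ) {t : ℝ} (ht : 0 < t) :
    ∃ ξ ∈ Set.Ioo (u - t) (u + t), secondDiff P u t = t ^ 2 * g ξ := by
  obtain ⟨η, hη, hPη⟩ := exists_secondDiff_eq_mul_sub hP u ht
  obtain ⟨ξ, hξ, hfξ⟩ := exists_hasDerivAt_mul_eq_sub hf η ht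
  exact ⟨ξ, ⟨hη.1.trans hξ.1, hξ.2.trans (by linarith [hη.2])⟩, by rw [hPη, hfξ]; ring⟩

theorem tendsto_zero_of_uniformContinuous_of_exists_near {f : ℝ → ℝ} {q : ℝ → ℝ → ℝ}
    {l : Filter ℝ} (hf : UniformContinuous f)
    (hq : ∀ h > 0, Tendsto (fun u => q u h) l (𝓝 0))
    (hmean : ∀ u, ∀ h > 0, ∃ ξ, |u - ξ| ≤ h ∧ q u h = f ξ) : Tendsto f l (𝓝 0) := by
  refine Metric.tendsto_nhds.2 fun ε hε => ?_
  obtain ⟨δ, hδ, hfδ⟩ := Metric.uniformContinuous_iff.1 hf (ε / 2) (half_pos hε)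
  filter_upwards [Metric.tendsto_nhds.1 (hq (δ / 2) (half_pos hδ)) (ε / 2) (half_pos hε)]
    with u hu
  obtain ⟨ξ, hξ, hqξ⟩ := hmean u (δ / 2) (half_pos hδ)
  rw [hqξ] at hu
  have hclose : dist (f u) (f ξ) < ε / 2 := hfδ (hξ.trans_lt (half_lt_self hδ))
  linarith [dist_triangle (f u) (f ξ) 0]

theorem tendsto_deriv_zero_of_uniformContinuous {P f : ℝ → ℝ} {l : Filter ℝ}
    (hP : ∀ x, HasDerivAt P (f x) x) (hf : UniformContinuous f)
    (hdiff : ∀ h, Tendsto (fun u => P (u + h) - P u) l (𝓝 0)) : Tendsto f l (𝓝 0) := by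
  refine tendsto_zero_of_uniformContinuous_of_exists_near hf
    (q := fun u h => (P (u + h) - P u) / h) (fun h _ => ?_) fun u h hh => ?_
  · simpa using (hdiff h).div_const h
  · obtain ⟨ξ, hξ, hmean⟩ := exists_hasDerivAt_mul_eq_sub hP u hh
    exact ⟨ξ, abs_le.2 ⟨by linarith [hξ.2], by linarith [hξ.1]⟩,
      by rw [hmean, mul_div_cancel_left₀ _ hh.ne']⟩

theorem tendsto_deriv_deriv_zero_of_uniformContinuous {P f g : ℝ → ℝ} {l : Filter ℝ}
    (hP : ∀ x, HasDerivAt P (f x) x) (hf : ∀ x, HasDerivAt f (g x) x) (hg : UniformContinuous g)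
    (hdiff : ∀ h, Tendsto (fun u => P (u + h) - P u) l (𝓝 0)) : Tendsto g l (𝓝 0) := by
  refine tendsto_zero_of_uniformContinuous_of_exists_near hg
    (q := fun u h => secondDiff P u h / h ^ 2) (fun h _ => ?_) fun u h hh => ?_
  · have hsum := ((hdiff h).add (hdiff (-h))).div_const (h ^ 2)
    rw [add_zero, zero_div] at hsum
    exact hsum.congr fun u => by rw [secondDiff, sub_eq_add_neg u]; ring
  · obtain ⟨ξ, hξ, hmean⟩ := exists_secondDiff_eq_sq_mul hP hf u hh
    exact ⟨ξ, abs_le.2 ⟨by linarith [hξ.2], by linarith [hξ.1]⟩,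
      by rw [hmean, mul_div_cancel_left₀ _ (by positivity)]⟩

theorem tendsto_intervalIntegral_add_sub_cocompact {f : ℝ → ℝ} (hf : Integrable f) (h : ℝ) :
    Tendsto (fun u => (∫ x in (0 : ℝ)..(u + h), f x) - ∫ x in (0 : ℝ)..u, f x) (cocompact ℝ)
      (𝓝 0) := by
  have hshift {l : Filter ℝ} {L : ℝ} (hl : Tendsto (fun u => u + h) l l)
      (hL : Tendsto (fun u => ∫ x in (0 : ℝ)..u, f x) l (𝓝 L)) :
      Tendsto (fun u => (∫ x in (0 : ℝ)..(u + h), f x) - ∫ x in (0 : ℝ)..u, f x) l (𝓝 0) := by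
    simpa using (hL.comp hl).sub hL
  rw [cocompact_eq_atBot_atTop]
  refine .sup
    (hshift (tendsto_atBot_add_const_right _ h tendsto_id) (L := -∫ x in Set.Iic 0, f x) ?_)
    (hshift (tendsto_atTop_add_const_right _ h tendsto_id)
      (intervalIntegral_tendsto_integral_Ioi 0 hf.integrableOn tendsto_id))
  simpa only [← intervalIntegral.integral_symm, id] using
    (intervalIntegral_tendsto_integral_Iic 0 hf.integrableOn tendsto_id).neg

theorem exists_abs_le_of_tendsto_zero_cocompact {g : ℝ → ℝ} (hg : Continuous g)
    (h0 : Tendsto g (cocompact ℝ) (𝓝 0)) : ∃ M, ∀ x, |g x| ≤ M :=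
  let G : ZeroAtInftyContinuousMap ℝ ℝ := ⟨⟨g, hg⟩, h0⟩
  ⟨‖G.toBCF‖, G.toBCF.norm_coe_le_norm⟩

/-- The properties of a profile `f` from which the continuity of its dispersion function up to the
real line is derived: `f` is an integrable `C¹` function that vanishes at infinity together with
its derivative, and the quotients `|secondDiff f u t| / t ^ 2` have an integrable majorant
independent of `u`. -/
structure IsRegularProfile (f : ℝ → ℝ) : Prop where
  differentiable : Differentiable ℝ f
  integrable : Integrable f
  continuous_deriv : Continuous (deriv f)
  tendsto_zero : Tendsto f (cocompact ℝ) (𝓝 0)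
  tendsto_deriv_zero : Tendsto (deriv f) (cocompact ℝ) (𝓝 0)
  exists_majorant : ∃ b : ℝ → ℝ, IntegrableOn b (Set.Ioi 0) ∧
    ∀ u, ∀ t > 0, |secondDiff f u t| / t ^ 2 ≤ b t

/-- A modulus of continuity `ω` satisfying Dini's condition `∫₀¹ ω(t) / t dt < ∞`. Only the values
of `ω` on `[0, ∞)` matter. -/
structure IsDiniModulus (ω : ℝ → ℝ) : Prop where
  monotoneOn : MonotoneOn ω (Set.Ici 0)
  integrableOn_div : IntegrableOn (fun t => ω t / t) (Set.Ioc 0 1)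

theorem isDiniModulus_const_mul_rpow (C : ℝ≥0) {α : ℝ} (hα : 0 < α) :
    IsDiniModulus fun t => C * t ^ α where
  monotoneOn := fun s hs t _ hst =>
    mul_le_mul_of_nonneg_left (Real.rpow_le_rpow hs hst hα.le) C.coe_nonneg
  integrableOn_div := by
    have hpow : IntegrableOn (fun t : ℝ => C * t ^ (α - 1)) (Set.Ioc 0 1) := by
      rw [← intervalIntegrable_iff_integrableOn_Ioc_of_le zero_le_one]
      exact (intervalIntegral.intervalIntegrable_rpow' (by linarith)).const_mul _
    refine hpow.congr_fun (fun t ht => ?_) measurableSet_Ioc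
    simp only [Real.rpow_sub_one ht.1.ne', mul_div_assoc]

theorem IsDiniModulus.exists_lt {ω : ℝ → ℝ} (hω : IsDiniModulus ω) {ε : ℝ} (hε : 0 < ε) :
    ∃ δ > 0, ω δ < ε := by
  by_contra! hge
  have hinv : IntegrableOn (fun t : ℝ => t⁻¹) (Set.Ioc 0 1) := by
    refine (hω.integrableOn_div.const_mul ε⁻¹).mono' (by fun_prop) ?_
    filter_upwards [ae_restrict_mem measurableSet_Ioc] with t ht
    rw [Real.norm_of_nonneg (inv_nonneg.2 ht.1.le), ← mul_div_assoc, inv_eq_one_div t]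
    gcongr
    · exact ht.1.le
    · exact (one_le_inv_mul₀ hε).2 (hge t ht.1)
  have hinv' : IntervalIntegrable (fun t : ℝ => t⁻¹) volume 0 1 :=
    (intervalIntegrable_iff_integrableOn_Ioc_of_le zero_le_one).2 hinv
  simp [intervalIntegrable_inv_iff] at hinv'

section Dini

variable {f g ω : ℝ → ℝ} (hω : IsDiniModulus ω) (hg : ∀ u v, |g u - g v| ≤ ω |u - v|)
include hω hg

theorem IsDiniModulus.uniformContinuous : UniformContinuous g := by
  refine Metric.uniformContinuous_iff.2 fun ε hε => ?_
  obtain ⟨δ, hδ, hωδ⟩ := hω.exists_lt hε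
  exact ⟨δ, hδ, fun {u v} huv =>
    ((hg u v).trans (hω.monotoneOn (abs_nonneg (u - v)) hδ.le huv.le)).trans_lt hωδ⟩

theorem IsDiniModulus.exists_majorant_secondDiff (hf : ∀ x, HasDerivAt f (g x) x) {K : ℝ}
    (hK : ∀ x, |f x| ≤ K) :
    ∃ b : ℝ → ℝ, IntegrableOn b (Set.Ioi 0) ∧ ∀ u, ∀ t > 0, |secondDiff f u t| / t ^ 2 ≤ b t := by
  refine ⟨fun t => if t ≤ 1 then ω t / t else 4 * K * t ^ (-2 : ℝ), ?_, fun u t ht => ?_⟩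
  · rw [← Set.Ioc_union_Ioi_eq_Ioi zero_le_one]
    refine .union ?_ ?_
    · exact hω.integrableOn_div.congr_fun (fun t ht => (if_pos ht.2).symm) measurableSet_Ioc
    · have hpow : IntegrableOn (fun t : ℝ => 4 * K * t ^ (-2 : ℝ)) (Set.Ioi 1) :=
        (integrableOn_Ioi_rpow_of_lt (by norm_num) one_pos).const_mul _
      exact hpow.congr_fun (fun t ht => (if_neg (not_le.2 ht)).symm) measurableSet_Ioi
  · dsimp only
    split_ifs with ht1
    · obtain ⟨ξ, -, hξ⟩ := exists_secondDiff_eq_mul_sub hf u ht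
      have hmod : |g (ξ + t) - g ξ| ≤ ω t := by
        simpa [abs_of_pos ht] using hg (ξ + t) ξ
      rw [hξ, abs_mul, abs_of_pos ht, pow_two, mul_div_mul_left _ _ ht.ne']
      gcongr
    · rw [Real.rpow_neg ht.le, Real.rpow_two, ← div_eq_mul_inv]
      gcongr
      exact abs_secondDiff_le hK u t

end Dini

theorem isRegularProfile_of_isDiniModulus {f ω : ℝ → ℝ} (hint : Integrable f)
    (hdiff : Differentiable ℝ f) (hω : IsDiniModulus ω)
    (hmod : ∀ u v, |deriv f u - deriv f v| ≤ ω |u - v|) : IsRegularProfile f := by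
  have hf (x : ℝ) : HasDerivAt f (deriv f x) x := (hdiff x).hasDerivAt
  have hP (x : ℝ) : HasDerivAt (fun u => ∫ y in (0 : ℝ)..u, f y) (f x) x :=
    (hdiff.continuous.integral_hasStrictDerivAt 0 x).hasDerivAt
  have hPdiff := tendsto_intervalIntegral_add_sub_cocompact hint
  have hderiv_unif : UniformContinuous (deriv f) := hω.uniformContinuous hmod
  have hderiv_zero : Tendsto (deriv f) (cocompact ℝ) (𝓝 0) :=
    tendsto_deriv_deriv_zero_of_uniformContinuous hP hf hderiv_unif hPdiff
  obtain ⟨M, hM⟩ := exists_abs_le_of_tendsto_zero_cocompact hderiv_unif.continuous hderiv_zero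
  have hf_unif : UniformContinuous f :=
    (lipschitzWith_of_nnnorm_deriv_le (C := M.toNNReal) hdiff fun x =>
      NNReal.coe_le_coe.1 ((hM x).trans (Real.le_coe_toNNReal M))).uniformContinuous
  have hf_zero : Tendsto f (cocompact ℝ) (𝓝 0) :=
    tendsto_deriv_zero_of_uniformContinuous hP hf_unif hPdiff
  obtain ⟨K, hK⟩ := exists_abs_le_of_tendsto_zero_cocompact hdiff.continuous hf_zero
  exact ⟨hdiff, hint, hderiv_unif.continuous, hf_zero, hderiv_zero,
    hω.exists_majorant_secondDiff hmod hf hK⟩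

/-! ### The Hilbert transform -/

theorem integral_eq_integral_Ioi_add_comp_neg {E : Type*} [NormedAddCommGroup E]
    [NormedSpace ℝ E] {φ : ℝ → E} (hφ : Integrable φ) :
    ∫ t, φ t = ∫ t in Set.Ioi 0, (φ t + φ (-t)) := by
  rw [integral_add hφ.integrableOn hφ.comp_neg.integrableOn, integral_comp_neg_Ioi, neg_zero,
    add_comm, intervalIntegral.integral_Iic_add_Ioi hφ.integrableOn hφ.integrableOn]

theorem truncatedHilbert_eq_intervalIntegral {g : ℝ → ℝ} (hg : Continuous g) (u : ℝ) {ε R : ℝ}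
    (hε : 0 < ε) (hR : ε ≤ R) :
    truncatedHilbert g u ε R = (1 / Real.pi) * ∫ t in ε..R, (g (u + t) - g (u - t)) * t⁻¹ := by
  set A : Set ℝ := {t | ε < |t| ∧ |t| < R}
  have hA : MeasurableSet A :=
    (isOpen_lt continuous_const continuous_abs |>.inter
      (isOpen_lt continuous_abs continuous_const)).measurableSet
  have hint : Integrable (A.indicator fun t => g (u + t) * t⁻¹) := by
    have hcompact : IsCompact (Metric.closedBall (0 : ℝ) R ∩ {t | ε ≤ |t|}) :=
      (isCompact_closedBall 0 R).inter_right (isClosed_le continuous_const continuous_abs)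
    have hcont : ContinuousOn (fun t => g (u + t) * t⁻¹)
        (Metric.closedBall (0 : ℝ) R ∩ {t | ε ≤ |t|}) :=
      .mul (by fun_prop) (continuousOn_inv₀.mono fun t ht => abs_pos.1 (hε.trans_le ht.2))
    refine ((hcont.integrableOn_compact hcompact).mono_set fun t ht => ?_).integrable_indicator hA
    exact ⟨mem_closedBall_zero_iff.2 ht.2.le, ht.1.le⟩
  have hfold : ∀ t ∈ Set.Ioi (0 : ℝ), A.indicator (fun t => g (u + t) * t⁻¹) t +
      A.indicator (fun t => g (u + t) * t⁻¹) (-t) =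
        (Set.Ioo ε R).indicator (fun t => (g (u + t) - g (u - t)) * t⁻¹) t := fun t ht => by
    simp only [A, Set.indicator_apply, Set.mem_ofPred_eq, abs_neg, abs_of_pos (Set.mem_Ioi.1 ht),
      Set.mem_Ioo]
    split_ifs
    · rw [inv_neg, ← sub_eq_add_neg]; ring
    · simp
  have hpos : Set.Ioo ε R ⊆ Set.Ioi 0 := fun t ht => lt_trans hε ht.1
  have hfold_integral : ∫ t in A, g (u + t) * t⁻¹ =
      ∫ t in ε..R, (g (u + t) - g (u - t)) * t⁻¹ := by
    rw [← integral_indicator hA, integral_eq_integral_Ioi_add_comp_neg hint,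
      setIntegral_congr_fun measurableSet_Ioi hfold, setIntegral_indicator measurableSet_Ioo,
      Set.inter_eq_right.2 hpos, intervalIntegral.integral_of_le hR,
      integral_Ioc_eq_integral_Ioo]
  have htranslate := (measurePreserving_add_left volume u).setIntegral_preimage_emb
    (measurableEmbedding_addLeft u) (fun v => g v / (v - u)) {v | ε < |v - u| ∧ |v - u| < R}
  simp only [Set.preimage_ofPred_eq, add_sub_cancel_left, div_eq_mul_inv] at htranslate
  simp only [truncatedHilbert, div_eq_mul_inv, ← htranslate]
  rw [← hfold_integral]

theorem intervalIntegral_sub_mul_inv_eq {f g : ℝ → ℝ} (hf : ∀ x, HasDerivAt f (g x) x)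
    (hg : Continuous g) (u : ℝ) {ε R : ℝ} (hε : 0 < ε) (hR : ε ≤ R) :
    ∫ t in ε..R, (g (u + t) - g (u - t)) * t⁻¹ =
      secondDiff f u R / R - secondDiff f u ε / ε + ∫ t in ε..R, secondDiff f u t / t ^ 2 := by
  have hpos (t : ℝ) (ht : t ∈ Set.uIcc ε R) : t ≠ 0 := by
    rw [Set.uIcc_of_le hR] at ht
    exact (hε.trans_le ht.1).ne'
  have hparts := intervalIntegral.integral_mul_deriv_eq_deriv_mul
    (fun t ht => hasDerivAt_inv (hpos t ht)) (fun t _ => hasDerivAt_secondDiff hf u t)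
    (ContinuousOn.intervalIntegrable (.neg (.inv₀ (by fun_prop)
      fun t ht => pow_ne_zero 2 (hpos t ht))))
    (Continuous.intervalIntegrable (by fun_prop) ε R)
  simp only [neg_mul, intervalIntegral.integral_neg, sub_neg_eq_add] at hparts
  simpa only [mul_comm, div_eq_mul_inv] using hparts

theorem tendsto_intervalIntegral_nhdsGT_prod_atTop {h : ℝ → ℝ}
    (hh : IntegrableOn h (Set.Ioi 0)) :
    Tendsto (fun p : ℝ × ℝ => ∫ t in p.1..p.2, h t) (𝓝[>] 0 ×ˢ atTop)
      (𝓝 (∫ t in Set.Ioi 0, h t)) := by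
  have hcover : AECover (volume.restrict (Set.Ioi (0 : ℝ))) (𝓝[>] 0 ×ˢ atTop)
      fun p : ℝ × ℝ => Set.Ioc p.1 p.2 :=
    (aecover_Ioi_of_Ioi (tendsto_fst.mono_right nhdsWithin_le_nhds)).inter
      (aecover_Iic tendsto_snd)
  refine (hcover.integral_tendsto_of_countably_generated hh).congr' ?_
  filter_upwards [tendsto_fst.eventually (self_mem_nhdsWithin (s := Set.Ioi (0 : ℝ))),
    tendsto_fst.eventually (nhdsWithin_le_nhds (Iio_mem_nhds one_pos)),
    tendsto_snd.eventually (eventually_ge_atTop (1 : ℝ))] with p hp0 hp1 hp2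
  have hsub : Set.Ioc p.1 p.2 ⊆ Set.Ioi 0 := fun t ht => lt_trans hp0 ht.1
  rw [Measure.restrict_restrict_of_subset hsub,
    intervalIntegral.integral_of_le (hp1.le.trans hp2)]

theorem tendsto_secondDiff_div_nhdsGT {f g : ℝ → ℝ} (hf : ∀ x, HasDerivAt f (g x) x) (u : ℝ) :
    Tendsto (fun t => secondDiff f u t / t) (𝓝[>] 0) (𝓝 0) := by
  have hslope := (hasDerivAt_iff_tendsto_slope.1 (hasDerivAt_secondDiff hf u 0)).mono_left
    (nhdsGT_le_nhdsNE 0)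
  simpa [slope_fun_def_field, secondDiff_zero] using hslope

theorem tendsto_secondDiff_div_atTop {f : ℝ → ℝ} {K : ℝ} (hK : ∀ x, |f x| ≤ K) (u : ℝ) :
    Tendsto (fun t => secondDiff f u t / t) atTop (𝓝 0) :=
  tendsto_bdd_div_atTop_nhds_zero
    (Eventually.of_forall fun t => (abs_le.1 (abs_secondDiff_le hK u t)).1)
    (Eventually.of_forall fun t => (abs_le.1 (abs_secondDiff_le hK u t)).2) tendsto_id

theorem hasHilbertTransformAt_of_integrableOn_secondDiff {f g : ℝ → ℝ} {K u : ℝ}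
    (hf : ∀ x, HasDerivAt f (g x) x) (hg : Continuous g) (hK : ∀ x, |f x| ≤ K)
    (hint : IntegrableOn (fun t => secondDiff f u t / t ^ 2) (Set.Ioi 0)) :
    HasHilbertTransformAt g u ((1 / Real.pi) * ∫ t in Set.Ioi 0, secondDiff f u t / t ^ 2) := by
  have hlim : Tendsto (fun p : ℝ × ℝ => secondDiff f u p.2 / p.2 - secondDiff f u p.1 / p.1 +
      ∫ t in p.1..p.2, secondDiff f u t / t ^ 2) (𝓝[>] 0 ×ˢ atTop)
      (𝓝 (∫ t in Set.Ioi 0, secondDiff f u t / t ^ 2)) := by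
    simpa using (((tendsto_secondDiff_div_atTop hK u).comp tendsto_snd).sub
      ((tendsto_secondDiff_div_nhdsGT hf u).comp tendsto_fst)).add
        (tendsto_intervalIntegral_nhdsGT_prod_atTop hint)
  refine (hlim.const_mul (1 / Real.pi)).congr' ?_
  filter_upwards [tendsto_fst.eventually (self_mem_nhdsWithin (s := Set.Ioi (0 : ℝ))),
    tendsto_fst.eventually (nhdsWithin_le_nhds (Iio_mem_nhds one_pos)),
    tendsto_snd.eventually (eventually_ge_atTop (1 : ℝ))] with p hp0 hp1 hp2
  have hp := hp1.le.trans hp2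
  rw [truncatedHilbert_eq_intervalIntegral hg u hp0 hp,
    intervalIntegral_sub_mul_inv_eq hf hg u hp0 hp]

theorem HasHilbertTransformAt.hilbertTransform_eq {g : ℝ → ℝ} {u h : ℝ}
    (hh : HasHilbertTransformAt g u h) : hilbertTransform g u = h :=
  hh.limUnder_eq

/-! ### Poisson integrals -/

theorem tendsto_add_cocompact_of_norm_le {ι E : Type*} [SeminormedAddCommGroup E] [ProperSpace E]
    {l : Filter ι} {u e : ι → E} {B : ℝ} (hu : Tendsto u l (cocompact E))
    (he : ∀ᶠ i in l, ‖e i‖ ≤ B) : Tendsto (fun i => u i + e i) l (cocompact E) := by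
  rw [← Metric.cobounded_eq_cocompact, ← tendsto_norm_atTop_iff_cobounded] at hu ⊢
  refine tendsto_atTop_mono' l ?_ (tendsto_atTop_add_const_right l (-B) hu)
  filter_upwards [he] with i hi
  linarith [norm_le_norm_add_norm_sub' (u i + e i) (u i), norm_le_add_norm_add (u i) (e i)]

/-- The Poisson integral of `g` at the point `u + iy` of the closed upper half plane, multiplied by
`π` and rescaled so that the formula extends continuously to `y = 0`. -/
noncomputable def poissonIntegral (g : ℝ → ℝ) (u y : ℝ) : ℝ :=
  ∫ s, g (u + y * s) * (1 + s ^ 2)⁻¹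

theorem poissonIntegral_zero_right (g : ℝ → ℝ) (u : ℝ) :
    poissonIntegral g u 0 = Real.pi * g u := by
  simp only [poissonIntegral, zero_mul, add_zero, integral_const_mul, integral_univ_inv_one_add_sq]
  exact mul_comm _ _

theorem poissonIntegral_eq_integral_mul_div (g : ℝ → ℝ) (u : ℝ) {y : ℝ} (hy : 0 < y) :
    poissonIntegral g u y = ∫ t, g (u + t) * (y / (t ^ 2 + y ^ 2)) := by
  have hscale := Measure.integral_comp_mul_left (fun t => g (u + t) * (y / (t ^ 2 + y ^ 2))) y
  rw [abs_of_pos (inv_pos.2 hy), smul_eq_mul, eq_inv_mul_iff_mul_eq₀ hy.ne',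
    ← integral_const_mul] at hscale
  rw [← hscale, poissonIntegral]
  congr 1 with s
  field_simp
  ring

section

variable {g : ℝ → ℝ} {M : ℝ} (hM : ∀ x, |g x| ≤ M)
include hM

theorem norm_mul_inv_one_add_sq_le (u y s : ℝ) :
    ‖g (u + y * s) * (1 + s ^ 2)⁻¹‖ ≤ M * (1 + s ^ 2)⁻¹ := by
  rw [norm_mul, Real.norm_of_nonneg (r := (1 + s ^ 2)⁻¹) (by positivity)]
  gcongr
  exact hM _

theorem continuous_poissonIntegral (hg : Continuous g) :
    Continuous fun p : ℝ × ℝ => poissonIntegral g p.1 p.2 :=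
  continuous_of_dominated
    (fun p => Continuous.aestronglyMeasurable (by fun_prop (disch := intros; positivity)))
    (fun p => ae_of_all _ (norm_mul_inv_one_add_sq_le hM p.1 p.2))
    (integrable_inv_one_add_sq.const_mul M) (ae_of_all _ fun s => by fun_prop)

theorem tendsto_poissonIntegral_zero (hg : Continuous g) (hg0 : Tendsto g (cocompact ℝ) (𝓝 0))
    {ι : Type*} {l : Filter ι} [l.IsCountablyGenerated] {u y : ι → ℝ} {B : ℝ}
    (hu : Tendsto u l (cocompact ℝ)) (hy : ∀ᶠ i in l, |y i| ≤ B) :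
    Tendsto (fun i => poissonIntegral g (u i) (y i)) l (𝓝 0) := by
  have hlim (s : ℝ) : Tendsto (fun i => g (u i + y i * s) * (1 + s ^ 2)⁻¹) l (𝓝 0) := by
    have hys : ∀ᶠ i in l, ‖y i * s‖ ≤ B * |s| := hy.mono fun i hi => by
      rw [Real.norm_eq_abs, abs_mul]
      gcongr
    simpa using (hg0.comp (tendsto_add_cocompact_of_norm_le hu hys)).mul_const (1 + s ^ 2)⁻¹
  simpa [poissonIntegral] using
    tendsto_integral_filter_of_dominated_convergence (fun s => M * (1 + s ^ 2)⁻¹)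
      (Eventually.of_forall fun i =>
        Continuous.aestronglyMeasurable (by fun_prop (disch := intros; positivity)))
      (Eventually.of_forall fun i => ae_of_all _ (norm_mul_inv_one_add_sq_le hM (u i) (y i)))
      (integrable_inv_one_add_sq.const_mul M) (ae_of_all _ hlim)

end

/-! ### The kernel of the dispersion function -/

/-- The real part of the kernel `1 / (t - iy) ^ 2`. -/
noncomputable def evenKernel (y t : ℝ) : ℝ := (t ^ 2 - y ^ 2) / (t ^ 2 + y ^ 2) ^ 2

/-- The imaginary part of the kernel `1 / (t - iy) ^ 2`. -/
noncomputable def oddKernel (y t : ℝ) : ℝ := 2 * y * t / (t ^ 2 + y ^ 2) ^ 2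

theorem evenKernel_zero_left (t : ℝ) : evenKernel 0 t = (t ^ 2)⁻¹ := by
  rcases eq_or_ne t 0 with rfl | ht
  · simp [evenKernel]
  · rw [evenKernel]
    field_simp
    ring

theorem inv_sub_mul_I_sq_eq {y : ℝ} (hy : y ≠ 0) (t : ℝ) :
    (((t : ℂ) - y * Complex.I) ^ 2)⁻¹ = evenKernel y t + Complex.I * oddKernel y t := by
  have hne : (t : ℂ) - y * Complex.I ≠ 0 := fun h => hy (by simpa using congrArg Complex.im h)
  have hne' : (t : ℂ) + y * Complex.I ≠ 0 := fun h => hy (by simpa using congrArg Complex.im h)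
  have hfactor : (t : ℂ) ^ 2 + y ^ 2 = (t - y * Complex.I) * (t + y * Complex.I) := by
    linear_combination (y : ℂ) ^ 2 * Complex.I_sq
  rw [evenKernel, oddKernel]
  push_cast
  rw [hfactor]
  field_simp
  linear_combination (y : ℂ) ^ 2 * Complex.I_sq

theorem abs_div_sq_le_inv {a c : ℝ} (hc : |a| ≤ c) : |a / c ^ 2| ≤ c⁻¹ := by
  rw [abs_div, abs_of_nonneg (sq_nonneg c)]
  calc |a| / c ^ 2 ≤ c / c ^ 2 := by gcongr
    _ = c⁻¹ := by rw [pow_two, div_self_mul_self']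

theorem abs_evenKernel_le (y t : ℝ) : |evenKernel y t| ≤ (t ^ 2 + y ^ 2)⁻¹ :=
  abs_div_sq_le_inv (abs_le.2 ⟨by linarith [sq_nonneg t], by linarith [sq_nonneg y]⟩)

theorem abs_oddKernel_le (y t : ℝ) : |oddKernel y t| ≤ (t ^ 2 + y ^ 2)⁻¹ :=
  abs_div_sq_le_inv (abs_le.2 ⟨by nlinarith [sq_nonneg (t + y)], by nlinarith [sq_nonneg (t - y)]⟩)

theorem hasDerivAt_div_sq_add_sq {y : ℝ} (hy : y ≠ 0) (t : ℝ) :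
    HasDerivAt (fun t => y / (t ^ 2 + y ^ 2)) (-oddKernel y t) t := by
  have hne : t ^ 2 + y ^ 2 ≠ 0 := by positivity
  refine (((hasDerivAt_pow 2 t).add_const (y ^ 2)).fun_inv hne |>.const_mul y).congr_deriv ?_
  rw [oddKernel]
  push_cast
  ring

theorem hasDerivAt_neg_div_sq_add_sq {y : ℝ} (hy : y ≠ 0) (t : ℝ) :
    HasDerivAt (fun t => -(t / (t ^ 2 + y ^ 2))) (evenKernel y t) t := by
  have hne : t ^ 2 + y ^ 2 ≠ 0 := by positivity
  have hderiv := ((hasDerivAt_id' t).fun_div ((hasDerivAt_pow 2 t).add_const (y ^ 2)) hne).fun_neg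
  refine hderiv.congr_deriv ?_
  rw [evenKernel]
  push_cast
  field_simp
  ring

theorem integrable_inv_sq_add_sq {y : ℝ} (hy : y ≠ 0) :
    Integrable fun t : ℝ => (t ^ 2 + y ^ 2)⁻¹ := by
  refine ((integrable_inv_one_add_sq.comp_div hy).const_mul (y ^ 2)⁻¹).congr
    (ae_of_all _ fun t => ?_)
  dsimp only
  field_simp
  ring

theorem measurable_evenKernel (y : ℝ) : Measurable (evenKernel y) := by
  unfold evenKernel
  fun_prop

theorem measurable_oddKernel (y : ℝ) : Measurable (oddKernel y) := by
  unfold oddKernel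
  fun_prop

theorem integrable_evenKernel {y : ℝ} (hy : y ≠ 0) : Integrable (evenKernel y) :=
  (integrable_inv_sq_add_sq hy).mono' (measurable_evenKernel y).aestronglyMeasurable
    (ae_of_all _ (abs_evenKernel_le y))

theorem setIntegral_Ioi_evenKernel {y : ℝ} (hy : y ≠ 0) : ∫ t in Set.Ioi 0, evenKernel y t = 0 := by
  have hlim : Tendsto (fun t : ℝ => -(t / (t ^ 2 + y ^ 2))) atTop (𝓝 0) := by
    rw [← neg_zero]
    refine (squeeze_zero' (g := fun t : ℝ => t⁻¹) ?_ ?_ tendsto_inv_atTop_zero).neg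
    · filter_upwards [eventually_gt_atTop 0] with t ht
      positivity
    · filter_upwards [eventually_gt_atTop 0] with t ht
      rw [inv_eq_one_div, div_le_div_iff₀ (by positivity) ht]
      linarith [sq_nonneg y]
  rw [integral_Ioi_of_hasDerivAt_of_tendsto' (fun t _ => hasDerivAt_neg_div_sq_add_sq hy t)
    (integrable_evenKernel hy).integrableOn hlim]
  simp

theorem inv_sq_add_sq_le {y : ℝ} (hy : y ≠ 0) (t : ℝ) : (t ^ 2 + y ^ 2)⁻¹ ≤ (y ^ 2)⁻¹ := by
  gcongr
  exact le_add_of_nonneg_left (sq_nonneg t)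

section

variable {f : ℝ → ℝ} (hint : Integrable f) (u : ℝ) {y : ℝ} (hy : y ≠ 0)
include hint hy

theorem integrable_mul_evenKernel : Integrable fun t => f (u + t) * evenKernel y t :=
  (hint.comp_add_left u).mul_bdd (measurable_evenKernel y).aestronglyMeasurable
    (ae_of_all _ fun t => (abs_evenKernel_le y t).trans (inv_sq_add_sq_le hy t))

theorem integrable_mul_oddKernel : Integrable fun t => f (u + t) * oddKernel y t :=
  (hint.comp_add_left u).mul_bdd (measurable_oddKernel y).aestronglyMeasurable
    (ae_of_all _ fun t => (abs_oddKernel_le y t).trans (inv_sq_add_sq_le hy t))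

theorem integral_mul_evenKernel_eq :
    ∫ t, f (u + t) * evenKernel y t = ∫ t in Set.Ioi 0, secondDiff f u t * evenKernel y t := by
  have hfold (t : ℝ) : f (u + t) * evenKernel y t + f (u + -t) * evenKernel y (-t) =
      secondDiff f u t * evenKernel y t + 2 * f u * evenKernel y t := by
    simp only [secondDiff, evenKernel, neg_sq, ← sub_eq_add_neg]
    ring
  have hk := integrable_mul_evenKernel hint u hy
  have hconst : IntegrableOn (fun t => 2 * f u * evenKernel y t) (Set.Ioi 0) :=
    ((integrable_evenKernel hy).const_mul _).integrableOn
  have hdiff : IntegrableOn (fun t => secondDiff f u t * evenKernel y t) (Set.Ioi 0) := by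
    refine ((hk.add hk.comp_neg).integrableOn.sub hconst).congr (ae_of_all _ fun t => ?_)
    exact sub_eq_of_eq_add (hfold t)
  rw [integral_eq_integral_Ioi_add_comp_neg hk]
  simp only [hfold]
  rw [integral_add hdiff hconst, integral_const_mul, setIntegral_Ioi_evenKernel hy, mul_zero,
    add_zero]

end

theorem integral_mul_oddKernel_eq {f g : ℝ → ℝ} {M : ℝ} (hf : ∀ x, HasDerivAt f (g x) x)
    (hint : Integrable f) (hg : Continuous g) (hM : ∀ x, |g x| ≤ M) (u : ℝ) {y : ℝ} (hy : 0 < y) :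
    ∫ t, f (u + t) * oddKernel y t = poissonIntegral g u y := by
  have hk : Integrable fun t : ℝ => y / (t ^ 2 + y ^ 2) :=
    (integrable_inv_sq_add_sq hy.ne').const_mul y
  have hfk : Integrable fun t => f (u + t) * (y / (t ^ 2 + y ^ 2)) := by
    refine (hint.comp_add_left u).mul_bdd hk.aestronglyMeasurable (c := y * (y ^ 2)⁻¹)
      (ae_of_all _ fun t => ?_)
    rw [Real.norm_of_nonneg (by positivity)]
    exact mul_le_mul_of_nonneg_left (inv_sq_add_sq_le hy.ne' t) hy.le
  have hgk : Integrable fun t => g (u + t) * (y / (t ^ 2 + y ^ 2)) :=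
    hk.bdd_mul (by fun_prop) (ae_of_all _ fun t => hM (u + t))
  have hparts := integral_mul_deriv_eq_deriv_mul_of_integrable
    (fun t _ => (hf (u + t)).comp_const_add u t) (fun t _ => hasDerivAt_div_sq_add_sq hy.ne' t)
    (by simpa [Pi.mul_def] using (integrable_mul_oddKernel hint u hy.ne').neg) hgk hfk
  rw [poissonIntegral_eq_integral_mul_div g u hy]
  simpa [integral_neg] using hparts

/-- The singular integral that gives the real part of `∫ f(v) / (v - z) ^ 2 dv` for `z = u + iy`
with `y > 0`, and the Hilbert transform of the derivative of `f` for `y = 0`. -/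
noncomputable def secondDiffIntegral (f : ℝ → ℝ) (u y : ℝ) : ℝ :=
  ∫ t in Set.Ioi 0, secondDiff f u t * evenKernel y t

theorem secondDiffIntegral_zero_right (f : ℝ → ℝ) (u : ℝ) :
    secondDiffIntegral f u 0 = ∫ t in Set.Ioi 0, secondDiff f u t / t ^ 2 := by
  simp only [secondDiffIntegral, evenKernel_zero_left, div_eq_mul_inv]

theorem norm_secondDiff_mul_evenKernel_le (f : ℝ → ℝ) (u y t : ℝ) :
    ‖secondDiff f u t * evenKernel y t‖ ≤ |secondDiff f u t| / t ^ 2 := by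
  rcases eq_or_ne t 0 with rfl | ht
  · simp [secondDiff_zero]
  · rw [norm_mul, div_eq_mul_inv, Real.norm_eq_abs, Real.norm_eq_abs]
    gcongr
    refine (abs_evenKernel_le y t).trans ?_
    rw [add_comm]
    exact inv_sq_add_sq_le ht y

section

variable {f b : ℝ → ℝ} (hf : Continuous f)
include hf

theorem aestronglyMeasurable_secondDiff_mul_evenKernel (u y : ℝ) {μ : Measure ℝ} :
    AEStronglyMeasurable (fun t => secondDiff f u t * evenKernel y t) μ :=
  ((continuous_secondDiff hf).comp (Continuous.prodMk_right u)).aestronglyMeasurable.mul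
    (measurable_evenKernel y).aestronglyMeasurable

variable (hbi : IntegrableOn b (Set.Ioi 0))
  (hb : ∀ u, ∀ t > 0, |secondDiff f u t| / t ^ 2 ≤ b t)
include hbi hb

theorem continuous_secondDiffIntegral :
    Continuous fun p : ℝ × ℝ => secondDiffIntegral f p.1 p.2 := by
  refine continuous_of_dominated
    (fun p => aestronglyMeasurable_secondDiff_mul_evenKernel hf p.1 p.2) (fun p => ?_) hbi ?_
  · filter_upwards [ae_restrict_mem measurableSet_Ioi] with t ht
    exact (norm_secondDiff_mul_evenKernel_le f p.1 p.2 t).trans (hb p.1 t ht)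
  · filter_upwards [ae_restrict_mem measurableSet_Ioi] with t ht
    have ht : t ≠ 0 := ne_of_gt ht
    exact ((continuous_secondDiff hf).comp (continuous_fst.prodMk continuous_const)).mul
      (.div (by fun_prop) (by fun_prop) fun p => by positivity)

theorem integrableOn_secondDiff_mul_evenKernel (u y : ℝ) :
    IntegrableOn (fun t => secondDiff f u t * evenKernel y t) (Set.Ioi 0) :=
  hbi.mono' (aestronglyMeasurable_secondDiff_mul_evenKernel hf u y) <|
    (ae_restrict_mem measurableSet_Ioi).mono fun t ht =>
      (norm_secondDiff_mul_evenKernel_le f u y t).trans (hb u t ht)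

theorem tendsto_secondDiffIntegral_zero (hf0 : Tendsto f (cocompact ℝ) (𝓝 0)) {ι : Type*}
    {l : Filter ι} [l.IsCountablyGenerated] {u : ι → ℝ} (hu : Tendsto u l (cocompact ℝ))
    (y : ι → ℝ) : Tendsto (fun i => secondDiffIntegral f (u i) (y i)) l (𝓝 0) := by
  have hshift (t : ℝ) : Tendsto (fun i => f (u i + t)) l (𝓝 0) :=
    hf0.comp (tendsto_add_cocompact_of_norm_le hu (Eventually.of_forall fun _ => le_rfl))
  have hlim (t : ℝ) : Tendsto (fun i => |secondDiff f (u i) t| / t ^ 2) l (𝓝 0) := by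
    simpa [secondDiff, sub_eq_add_neg] using
      ((((hshift t).add (hshift (-t))).sub ((hf0.comp hu).const_mul 2)).abs.div_const (t ^ 2))
  simpa [secondDiffIntegral] using tendsto_integral_filter_of_dominated_convergence b
    (Eventually.of_forall fun i => aestronglyMeasurable_secondDiff_mul_evenKernel hf (u i) (y i))
    (Eventually.of_forall fun i => (ae_restrict_mem measurableSet_Ioi).mono fun t ht =>
      (norm_secondDiff_mul_evenKernel_le f (u i) (y i) t).trans (hb (u i) t ht)) hbi
    (ae_of_all _ fun t => squeeze_zero_norm
      (fun i => norm_secondDiff_mul_evenKernel_le f (u i) (y i) t) (hlim t))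

end

/-! ### The dispersion function -/

section

variable {f : ℝ → ℂ} {μ : Measure ℝ}

theorem im_le_norm_ofReal_sub (z : ℂ) (v : ℝ) : z.im ≤ ‖(v : ℂ) - z‖ := by
  simpa using (neg_le_abs _).trans (Complex.abs_im_le_norm ((v : ℂ) - z))

theorem norm_div_ofReal_sub_pow_le {z : ℂ} {d : ℝ} (hd : 0 < d) (hz : d ≤ z.im) (n : ℕ) (v : ℝ) :
    ‖f v / ((v : ℂ) - z) ^ n‖ ≤ (d ^ n)⁻¹ * ‖f v‖ := by
  rw [norm_div, norm_pow, div_eq_inv_mul]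
  have := hz.trans (im_le_norm_ofReal_sub z v)
  gcongr

theorem aestronglyMeasurable_div_ofReal_sub_pow (hf : AEStronglyMeasurable f μ) (z : ℂ) (n : ℕ) :
    AEStronglyMeasurable (fun v : ℝ => f v / ((v : ℂ) - z) ^ n) μ :=
  (hf.aemeasurable.div (by fun_prop)).aestronglyMeasurable

theorem integrable_div_ofReal_sub_pow (hf : Integrable f μ) {z : ℂ} (hz : 0 < z.im) (n : ℕ) :
    Integrable (fun v : ℝ => f v / ((v : ℂ) - z) ^ n) μ :=
  (hf.norm.const_mul (z.im ^ n)⁻¹).mono'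
    (aestronglyMeasurable_div_ofReal_sub_pow hf.aestronglyMeasurable z n)
    (ae_of_all _ (norm_div_ofReal_sub_pow_le hz le_rfl n))

theorem norm_integral_div_ofReal_sub_pow_le (hf : Integrable f μ) {z : ℂ} (hz : 0 < z.im) (n : ℕ) :
    ‖∫ v : ℝ, f v / ((v : ℂ) - z) ^ n ∂μ‖ ≤ (z.im ^ n)⁻¹ * ∫ v, ‖f v‖ ∂μ := by
  rw [← integral_const_mul]
  exact norm_integral_le_of_norm_le (hf.norm.const_mul _)
    (ae_of_all _ (norm_div_ofReal_sub_pow_le hz le_rfl n))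

theorem hasDerivAt_integral_div_ofReal_sub_pow (hf : Integrable f μ) {z : ℂ} (hz : 0 < z.im)
    (n : ℕ) :
    HasDerivAt (fun z => ∫ v : ℝ, f v / ((v : ℂ) - z) ^ n ∂μ)
      (∫ v : ℝ, n * (f v / ((v : ℂ) - z) ^ (n + 1)) ∂μ) z := by
  have hhalf : 0 < z.im / 2 := half_pos hz
  have hnhds : {w : ℂ | z.im / 2 < w.im} ∈ 𝓝 z :=
    (isOpen_lt continuous_const Complex.continuous_im).mem_nhds (half_lt_self hz)
  refine (hasDerivAt_integral_of_dominated_loc_of_deriv_le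
    (F' := fun w v => n * (f v / ((v : ℂ) - w) ^ (n + 1)))
    (bound := fun v => n * (((z.im / 2) ^ (n + 1))⁻¹ * ‖f v‖)) hnhds
    (Eventually.of_forall fun w =>
      aestronglyMeasurable_div_ofReal_sub_pow hf.aestronglyMeasurable w n)
    (integrable_div_ofReal_sub_pow hf hz n)
    ((aestronglyMeasurable_div_ofReal_sub_pow hf.aestronglyMeasurable z (n + 1)).const_mul _)
    (ae_of_all _ fun v w hw => ?_) ((hf.norm.const_mul _).const_mul _)
    (ae_of_all _ fun v w hw => ?_)).2
  · rw [norm_mul, RCLike.norm_natCast]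
    exact mul_le_mul_of_nonneg_left (norm_div_ofReal_sub_pow_le hhalf hw.le (n + 1) v)
      n.cast_nonneg
  · have hne : (v : ℂ) - w ≠ 0 := norm_pos_iff.1 <|
      (hhalf.trans hw).trans_le (im_le_norm_ofReal_sub w v)
    refine ((((hasDerivAt_id' w).const_sub (v : ℂ)).fun_pow n).fun_inv (pow_ne_zero n hne)
      |>.const_mul (f v)).congr_deriv ?_
    rcases n with _ | n
    · simp
    · rw [Nat.add_sub_cancel]
      field_simp
      ring

end

theorem integral_div_ofReal_sub_sq_eq {f : ℝ → ℝ} (hint : Integrable f) {z : ℂ} (hz : 0 < z.im) :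
    ∫ v : ℝ, (f v : ℂ) / ((v : ℂ) - z) ^ 2 =
      ((∫ t, f (z.re + t) * evenKernel z.im t : ℝ) : ℂ) +
        Complex.I * (∫ t, f (z.re + t) * oddKernel z.im t : ℝ) := by
  have hkernel (t : ℝ) : (f (z.re + t) : ℂ) / (((z.re + t : ℝ) : ℂ) - z) ^ 2 =
      ((f (z.re + t) * evenKernel z.im t : ℝ) : ℂ) +
        Complex.I * (f (z.re + t) * oddKernel z.im t : ℝ) := by
    have hz' : ((z.re + t : ℝ) : ℂ) - z = t - z.im * Complex.I := by
      apply Complex.ext <;> simp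
    rw [hz', div_eq_mul_inv, inv_sub_mul_I_sq_eq hz.ne']
    push_cast
    ring
  rw [← integral_add_left_eq_self _ z.re]
  simp only [hkernel]
  rw [integral_add (integrable_mul_evenKernel hint z.re hz.ne').ofReal
    ((integrable_mul_oddKernel hint z.re hz.ne').ofReal.const_mul _), integral_const_mul,
    integral_complex_ofReal, integral_complex_ofReal]

/-- The plasma dispersion function `z ↦ 1 - (1/π) ∫ f'(v) / (v - z) dv` of the profile `f` on the
closed upper half plane, written in terms of integrals that converge up to the real line. -/
noncomputable def dispersionFunction (f : ℝ → ℝ) (z : ℂ) : ℂ :=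
  1 - (Real.pi : ℂ)⁻¹ * (secondDiffIntegral f z.re z.im +
    Complex.I * poissonIntegral (deriv f) z.re z.im)

namespace IsRegularProfile

variable {f : ℝ → ℝ} (hf : IsRegularProfile f)
include hf

theorem hasDerivAt (x : ℝ) : HasDerivAt f (deriv f x) x :=
  (hf.differentiable x).hasDerivAt

theorem exists_abs_deriv_le : ∃ M, ∀ x, |deriv f x| ≤ M :=
  exists_abs_le_of_tendsto_zero_cocompact hf.continuous_deriv hf.tendsto_deriv_zero

theorem continuous_dispersionFunction : Continuous (dispersionFunction f) := by
  obtain ⟨b, hbi, hb⟩ := hf.exists_majorant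
  obtain ⟨M, hM⟩ := hf.exists_abs_deriv_le
  have hreim : Continuous fun z : ℂ => (z.re, z.im) := by fun_prop
  have hsecond := (continuous_secondDiffIntegral hf.differentiable.continuous hbi hb).comp hreim
  have hpoisson := (continuous_poissonIntegral hM hf.continuous_deriv).comp hreim
  unfold dispersionFunction
  fun_prop

theorem dispersionFunction_eq_integral {z : ℂ} (hz : 0 < z.im) :
    dispersionFunction f z =
      1 - (Real.pi : ℂ)⁻¹ * ∫ v : ℝ, (f v : ℂ) / ((v : ℂ) - z) ^ 2 := by
  obtain ⟨M, hM⟩ := hf.exists_abs_deriv_le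
  rw [dispersionFunction, integral_div_ofReal_sub_sq_eq hf.integrable hz,
    integral_mul_evenKernel_eq hf.integrable z.re hz.ne',
    integral_mul_oddKernel_eq hf.hasDerivAt hf.integrable hf.continuous_deriv hM z.re hz,
    secondDiffIntegral]

theorem diffContOnCl_dispersionFunction :
    DiffContOnCl ℂ (dispersionFunction f) {z | 0 < z.im} where
  differentiableOn := by
    refine DifferentiableOn.congr (fun z hz => ?_) fun z hz => hf.dispersionFunction_eq_integral hz
    exact ((hasDerivAt_integral_div_ofReal_sub_pow hf.integrable.ofReal hz 2).differentiableAt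
      |>.const_mul _ |>.const_sub 1).differentiableWithinAt
  continuousOn := hf.continuous_dispersionFunction.continuousOn

theorem tendsto_dispersionFunction_strip (B : ℝ) :
    Tendsto (dispersionFunction f) (cocompact ℂ ⊓ 𝓟 {z | |z.im| ≤ B}) (𝓝 1) := by
  obtain ⟨b, hbi, hb⟩ := hf.exists_majorant
  obtain ⟨M, hM⟩ := hf.exists_abs_deriv_le
  have : (cocompact ℂ).IsCountablyGenerated := by
    rw [← Metric.cobounded_eq_cocompact, ← comap_norm_atTop]
    infer_instance
  have him : ∀ᶠ z : ℂ in cocompact ℂ ⊓ 𝓟 {z | |z.im| ≤ B}, |z.im| ≤ B :=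
    mem_inf_of_right (mem_principal_self _)
  have hre : Tendsto Complex.re (cocompact ℂ ⊓ 𝓟 {z | |z.im| ≤ B}) (cocompact ℝ) := by
    rw [← Metric.cobounded_eq_cocompact (α := ℝ), ← tendsto_norm_atTop_iff_cobounded]
    refine tendsto_atTop_mono' _ ?_ (tendsto_atTop_add_const_right _ (-B)
      ((tendsto_norm_cocompact_atTop (E := ℂ)).mono_left inf_le_left))
    filter_upwards [him] with z hz
    rw [Real.norm_eq_abs]
    linarith [Complex.norm_le_abs_re_add_abs_im z]
  have hsecond := (tendsto_secondDiffIntegral_zero hf.differentiable.continuous hbi hb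
    hf.tendsto_zero hre Complex.im).ofReal
  have hpoisson := (tendsto_poissonIntegral_zero hM hf.continuous_deriv hf.tendsto_deriv_zero
    hre him).ofReal
  unfold dispersionFunction
  simpa using
    ((hsecond.add (hpoisson.const_mul Complex.I)).const_mul (Real.pi : ℂ)⁻¹).const_sub 1

theorem norm_dispersionFunction_sub_one_le {z : ℂ} (hz : 0 < z.im) :
    ‖dispersionFunction f z - 1‖ ≤ Real.pi⁻¹ * ((z.im ^ 2)⁻¹ * ∫ v, ‖f v‖) := by
  rw [hf.dispersionFunction_eq_integral hz, sub_sub_cancel_left, norm_neg, norm_mul, norm_inv,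
    Complex.norm_real, Real.norm_of_nonneg Real.pi_pos.le]
  gcongr
  simpa using norm_integral_div_ofReal_sub_pow_le hf.integrable.ofReal hz 2

theorem tendsto_dispersionFunction :
    Tendsto (dispersionFunction f) (cocompact ℂ ⊓ 𝓟 {z | 0 ≤ z.im}) (𝓝 1) := by
  refine Metric.tendsto_nhds.2 fun ε hε => ?_
  have hbound : Tendsto (fun B : ℝ => Real.pi⁻¹ * ((B ^ 2)⁻¹ * ∫ v, ‖f v‖)) atTop (𝓝 0) := by
    simpa using ((tendsto_inv_atTop_zero.comp (tendsto_pow_atTop (α := ℝ) two_ne_zero)).mul_const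
      (∫ v, ‖f v‖)).const_mul Real.pi⁻¹
  obtain ⟨B, hBε, hB⟩ :=
    ((hbound.eventually (gt_mem_nhds hε)).and (eventually_gt_atTop 0)).exists
  have hstrip := Metric.tendsto_nhds.1 (hf.tendsto_dispersionFunction_strip B) ε hε
  rw [eventually_inf_principal] at hstrip ⊢
  filter_upwards [hstrip] with z hzstrip hz0
  rcases le_or_gt z.im B with hzB | hBz
  · exact hzstrip ((abs_of_nonneg hz0).le.trans hzB)
  · rw [dist_eq_norm]
    refine ((hf.norm_dispersionFunction_sub_one_le (hB.trans hBz)).trans ?_).trans_lt hBε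
    have : 0 ≤ ∫ v, ‖f v‖ := integral_nonneg fun v => norm_nonneg _
    gcongr

theorem hasHilbertTransformAt_deriv (u : ℝ) :
    HasHilbertTransformAt (deriv f) u (Real.pi⁻¹ * secondDiffIntegral f u 0) := by
  obtain ⟨b, hbi, hb⟩ := hf.exists_majorant
  obtain ⟨K, hK⟩ :=
    exists_abs_le_of_tendsto_zero_cocompact hf.differentiable.continuous hf.tendsto_zero
  rw [secondDiffIntegral_zero_right, ← one_div]
  refine hasHilbertTransformAt_of_integrableOn_secondDiff hf.hasDerivAt hf.continuous_deriv hK ?_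
  simpa only [evenKernel_zero_left, div_eq_mul_inv] using
    integrableOn_secondDiff_mul_evenKernel hf.differentiable.continuous hbi hb u 0

theorem dispersionFunction_ofReal (u : ℝ) :
    dispersionFunction f u =
      1 - (hilbertTransform (deriv f) u : ℂ) - Complex.I * ((deriv f u : ℝ) : ℂ) := by
  have hpi : (Real.pi : ℂ) ≠ 0 := Complex.ofReal_ne_zero.2 Real.pi_ne_zero
  rw [(hf.hasHilbertTransformAt_deriv u).hilbertTransform_eq, dispersionFunction,
    Complex.ofReal_re, Complex.ofReal_im, poissonIntegral_zero_right]
  push_cast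
  field_simp
  ring

theorem penrosePlot_deriv :
    penrosePlot (deriv f) = closeAtInfty 1 fun u : ℝ => dispersionFunction f u := by
  simp only [penrosePlot, hf.dispersionFunction_ofReal]

theorem penrosePlot'_deriv :
    penrosePlot' (deriv f) = closeAtInfty 1 fun u : ℝ => 2 - dispersionFunction f u := by
  rw [penrosePlot']
  congr 1 with u
  rw [hf.dispersionFunction_ofReal]
  push_cast
  ring

end IsRegularProfile

theorem mainTheorem7_general (f₀ : ℝ → ℝ) (hf₀ : Integrable f₀) (hdiff : Differentiable ℝ f₀)
    (ω : ℝ → ℝ) (hω : IsDiniModulus ω)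
    (hmod : ∀ u v, |deriv f₀ u - deriv f₀ v| ≤ ω |u - v|) :
    (∀ u : ℝ, HasHilbertTransformAt (deriv f₀) u (hilbertTransform (deriv f₀) u)) ∧
    (Continuous (penrosePlot (deriv f₀)) ∧
      ((∀ u : ℝ, penrosePlot (deriv f₀) u ≠ 0) →
        (∃! n : ℤ, HasWindingNumber (penrosePlot (deriv f₀)) 0 n) ∧
        ∀ n : ℤ, HasWindingNumber (penrosePlot (deriv f₀)) 0 n → 0 ≤ n)) ∧
    (Continuous (penrosePlot' (deriv f₀)) ∧
      ((∀ u : ℝ, penrosePlot' (deriv f₀) u ≠ 0) →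
        (∃! n : ℤ, HasWindingNumber (penrosePlot' (deriv f₀)) 0 n) ∧
        ∀ n : ℤ, HasWindingNumber (penrosePlot' (deriv f₀)) 0 n → 0 ≤ n)) := by
  have hf := isRegularProfile_of_isDiniModulus hf₀ hdiff hω hmod
  have hD := hf.diffContOnCl_dispersionFunction
  have hD1 := hf.tendsto_dispersionFunction
  have hD' := hD.const_sub 2
  have hD1' : Tendsto (fun z => 2 - dispersionFunction f₀ z) (cocompact ℂ ⊓ 𝓟 {z | 0 ≤ z.im})
      (𝓝 1) := by
    convert hD1.const_sub 2 using 2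
    norm_num
  rw [hf.penrosePlot_deriv, hf.penrosePlot'_deriv]
  refine ⟨fun u => ?_, ⟨continuous_closeAtInfty_boundary_values hD hD1,
    existsUnique_hasWindingNumber_boundary_values hD hD1 one_ne_zero⟩,
    continuous_closeAtInfty_boundary_values hD' hD1',
    existsUnique_hasWindingNumber_boundary_values hD' hD1' one_ne_zero⟩
  have hu := hf.hasHilbertTransformAt_deriv u
  rwa [hu.hilbertTransform_eq]

theorem mainTheorem7 (f₀ : ℝ → ℝ) (hf₀ : Integrable f₀) (hdiff : Differentiable ℝ f₀)
    (C α : ℝ≥0) (hα : 0 < α) (hHolder : HolderWith C α (deriv f₀)) :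
    (∀ u : ℝ, HasHilbertTransformAt (deriv f₀) u (hilbertTransform (deriv f₀) u)) ∧
    (Continuous (penrosePlot (deriv f₀)) ∧
      ((∀ u : ℝ, penrosePlot (deriv f₀) u ≠ 0) →
        (∃! n : ℤ, HasWindingNumber (penrosePlot (deriv f₀)) 0 n) ∧
        ∀ n : ℤ, HasWindingNumber (penrosePlot (deriv f₀)) 0 n → 0 ≤ n)) ∧
    (Continuous (penrosePlot' (deriv f₀)) ∧
      ((∀ u : ℝ, penrosePlot' (deriv f₀) u ≠ 0) →
        (∃! n : ℤ, HasWindingNumber (penrosePlot' (deriv f₀)) 0 n) ∧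
        ∀ n : ℤ, HasWindingNumber (penrosePlot' (deriv f₀)) 0 n → 0 ≤ n)) :=
  mainTheorem7_general f₀ hf₀ hdiff _ (isDiniModulus_const_mul_rpow C (NNReal.coe_pos.2 hα))
    fun u v => by simpa only [Real.dist_eq] using hHolder.dist_le u v
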